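/- An energy-harvesting transmitter with a single sub-carrier has a battery with levels $\mathcal E=\{0,\dots,e_{\max}\}$. In each slot the pair of channel gains $(g,h)$ (legitimate receiver, eavesdropper) is drawn i.i.d. from a distribution on a finite set $\mathcal C\subset[0,\infty)^2$ with every element of $\mathcal C$ of positive probability, and $B$ energy quanta arrive, i.i.d. over time, independent of the channel, $B\in\{0,\dots,b_{\max}\}$. A (deterministic, full-CSI) policy $\mu$ chooses a transmit power $\rho_{e,g,h}\in\{0,\dots,e\}$ for every battery level $e$ and channel state $(g,h)$; the battery then evolves as $E^{(k+1)}=\min\{E^{(k)}-\rho_{E^{(k)},g^{(k)},h^{(k)}}+B^{(k)},\,e_{\max}\}$, and the slot contributes the secrecy rate $R_{g,h}(\rho)=\log_2(1+g\rho)-\log_2(1+h\rho)$ (constant rate coding) or $R_{g,h}(\rho)=\log_2(1+g\rho)-\log_2(1+\min\{g,h\}\rho)$ (variable rate coding). The long-term secrecy rate is $$C_\mu(E^{(0)})=\Big[\liminf_{K\to\infty}\frac1{K+1}\sum_{k=0}^{K}\mathbb E\big[R_{g^{(k)},h^{(k)}}(\rho_{E^{(k)},g^{(k)},h^{(k)}})\,\big|\,E^{(0)}\big]\Big]^+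 .$$ A policy is unichain if the battery Markov chain it induces has a single recurrent class. An optimal secrecy policy (OSP) is a unichain policy that maximizes $C_\mu(E^{(0)})$ among unichain policies, for every $E^{(0)}$, with the usual normalization that it uses zero power at transient battery levels and whenever $g\le h$. Theorem. For either coding scheme, let $\rho^\star_{e,g,h}$ be the transmit power of an OSP. Then for every battery level $e\in\mathcal E$: - if $(g',h),(g'',h)\in\mathcal C$ and $g''\ge g'$, then $\rho^\star_{e,g'',h}\ge\rho^\star_{e,g',h}$; - if $(g,h'),(g,h'')\in\mathcal C$ and $h''\ge h'$, then $\rho^\star_{e,g,h''}\le\rho^\star_{e,g,h'}$. -/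

import Mathlib

open scoped BigOperators

noncomputable section

namespace EnergyHarvestingSecrecy

/-- The two coding strategies: the code rate is adapted to the legitimate channel, or kept
constant. -/
inductive Coding where
  | variableRate
  | constantRate

/-- Instantaneous secrecy rate with legitimate gain `g`, eavesdropper gain `h` and transmission
power `ρ` (in bits). -/
def secrecyRate (s : Coding) (g h ρ : ℝ) : ℝ :=
  match s with
  | .variableRate => Real.logb 2 (1 + g * ρ) - Real.logb 2 (1 + min g h * ρ)
  | .constantRate => Real.logb 2 (1 + g * ρ) - Real.logb 2 (1 + h * ρ)

/-- An energy harvesting transmitter with a single sub-carrier: a battery with levels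
`0, …, eMax`, energy arrivals in `{0, …, bMax}` (i.i.d. with mass function `harvest`, independent
of the channel), and a pair of channel gains (i.i.d. over time) that takes finitely many values
`(g, h) ∈ channels`, each with positive probability. The two gains may be correlated. -/
structure Model where
  eMax : ℕ
  bMax : ℕ
  harvest : ℕ → ℝ
  harvest_nonneg : ∀ b, 0 ≤ harvest b
  harvest_sum : ∑ b ∈ Finset.range (bMax + 1), harvest b = 1
  channels : Finset (ℝ × ℝ)
  gains_nonneg : ∀ x ∈ channels, 0 ≤ x.1 ∧ 0 ≤ x.2
  prob : ℝ × ℝ → ℝ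
  prob_pos : ∀ x ∈ channels, 0 < prob x
  prob_sum : ∑ x ∈ channels, prob x = 1
  coding : Coding

/-- Battery levels. -/
abbrev Model.Level (M : Model) : Type := Fin (M.eMax + 1)

/-- A deterministic policy with full channel state information: the number of energy quanta used
in a slot, as a function of the battery level and of both channel gains. Only its values at
`(g, h) ∈ M.channels` matter. -/
structure Policy (M : Model) where
  power : M.Level → ℝ → ℝ → ℕ
  power_le : ∀ e g h, power e g h ≤ (e : ℕ)

variable {M : Model}

/-- One-step transition matrix of the battery level,
`E ↦ min (E - ρ + B) eMax` with `ρ = μ (E, G, H)`. -/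
def Policy.transition (μ : Policy M) : Matrix M.Level M.Level ℝ := fun e e' =>
  ∑ x ∈ M.channels, M.prob x * ∑ b ∈ Finset.range (M.bMax + 1),
    M.harvest b * if min ((e : ℕ) - μ.power e x.1 x.2 + b) M.eMax = (e' : ℕ) then 1 else 0

/-- Expected secrecy rate in a slot that starts with battery level `e`. -/
def Policy.reward (μ : Policy M) (e : M.Level) : ℝ :=
  ∑ x ∈ M.channels, M.prob x * secrecyRate M.coding x.1 x.2 (μ.power e x.1 x.2)

/-- Long-term average secrecy rate `C_μ(E⁽⁰⁾)` starting from the battery level `e₀`. -/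
def Policy.secrecy (μ : Policy M) (e₀ : M.Level) : ℝ :=
  max 0 (Filter.liminf (fun K : ℕ => (1 / ((K : ℝ) + 1)) *
    ∑ k ∈ Finset.range (K + 1), ∑ e : M.Level, (μ.transition ^ k) e₀ e * μ.reward e)
    Filter.atTop)

/-- The battery can move from level `e` to level `e'` in finitely many (possibly zero) slots. -/
def Policy.Reaches (μ : Policy M) : M.Level → M.Level → Prop :=
  Relation.ReflTransGen fun e e' => 0 < μ.transition e e'

/-- `e` is a recurrent level of the (finite) battery chain. Levels that are not recurrent are
transient. -/
def Policy.IsRecurrent (μ : Policy M) (e : M.Level) : Prop :=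
  ∀ e', μ.Reaches e e' → μ.Reaches e' e

/-- The battery chain has a single recurrent class. -/
def Policy.IsUnichain (μ : Policy M) : Prop :=
  ∀ e e', μ.IsRecurrent e → μ.IsRecurrent e' → μ.Reaches e e'

/-- Optimal secrecy policies: unichain policies that maximize the long-term average secrecy rate,
with the two normalizations that remove immaterial choices: no energy is spent in transient
battery levels, and none when the eavesdropper's channel is at least as good as the
legitimate one. -/
structure Policy.IsOptimalSecrecy (μ : Policy M) : Prop where
  unichain : μ.IsUnichain
  optimal : ∀ ν : Policy M, ν.IsUnichain → ∀ e₀, ν.secrecy e₀ ≤ μ.secrecy e₀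
  silent_of_transient : ∀ e, ¬ μ.IsRecurrent e → ∀ x ∈ M.channels, μ.power e x.1 x.2 = 0
  silent_of_le : ∀ e, ∀ x ∈ M.channels, x.1 ≤ x.2 → μ.power e x.1 x.2 = 0

end EnergyHarvestingSecrecy

end

/-! This is monotone comparative statics on a Bellman condition. At a recurrent level `a`, raising
the action value in one channel state would strictly raise the long-run gain: the deviation alters
only the row of `a`, which stays reachable from everywhere, and a Poisson equation compares the two
gains (`exists_bellman`). So each power maximizes rate plus continuation value. The latter does not
depend on the current channel, so it cancels when two channel states exchange actions
(`power_le_power`), leaving the strictly increasing differences of the logarithm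
(`logb_sub_logb_lt`). Transient levels and channels with `g ≤ h` are covered by the normalization.
-/

namespace EnergyHarvestingSecrecy

/-! ### Poisson equations for finite Markov chains. -/

section StochasticMatrix

variable {ι : Type*} [Fintype ι]

/-- A superharmonic function of a finite chain is minimal at a state that is reachable from
everywhere. -/
theorem superharmonic_min {P : Matrix ι ι ℝ} (hP : ∀ s t, 0 ≤ P s t) (hP1 : ∀ s, ∑ t, P s t = 1)
    {a : ι} (ha : ∀ s, Relation.ReflTransGen (fun s t => 0 < P s t) s a) {D : ι → ℝ}
    (hD : ∀ s, ∑ t, P s t * D t ≤ D s) (s : ι) : D a ≤ D s := by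
  obtain ⟨m, -, hm⟩ := Finset.exists_min_image Finset.univ D ⟨a, Finset.mem_univ a⟩
  have key : ∀ t, Relation.ReflTransGen (fun s t => 0 < P s t) m t → D t ≤ D m := by
    intro t ht
    induction ht with
    | refl => exact le_rfl
    | @tail u v _ huv ih =>
      -- Minimality propagates along positive transitions: a larger value at `v` would push the row
      -- average at `u` above the minimum.
      by_contra! hlt
      have h1 : ∑ t, P u t * D m < ∑ t, P u t * D t :=
        Finset.sum_lt_sum
          (fun t _ => mul_le_mul_of_nonneg_left (hm t (Finset.mem_univ t)) (hP u t))
          ⟨v, Finset.mem_univ v, mul_lt_mul_of_pos_left hlt huv⟩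
      rw [← Finset.sum_mul, hP1, one_mul] at h1
      linarith [hD u]
  exact (key a (ha m)).trans (hm s (Finset.mem_univ s))

/-- In a Poisson equation with nonnegative reward `d`, the average reward is positive or bounds
the reward at a state that is reachable from everywhere. -/
theorem gain_pos_or_le {P : Matrix ι ι ℝ} (hP : ∀ s t, 0 ≤ P s t) (hP1 : ∀ s, ∑ t, P s t = 1)
    {a : ι} (ha : ∀ s, Relation.ReflTransGen (fun s t => 0 < P s t) s a) {D d : ι → ℝ} {c : ℝ}
    (hd : ∀ s, 0 ≤ d s) (h : ∀ s, D s + c = d s + ∑ t, P s t * D t) : 0 < c ∨ d a ≤ c := by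
  -- If `c ≤ 0`, then `D` is superharmonic, hence minimal at `a`, and the equation at `a` gives `d a
  -- ≤ c`.
  by_contra! hc
  have hmin := superharmonic_min hP hP1 ha (D := D) (fun s => by linarith [h s, hd s, hc.1])
  have h1 : ∑ t, P a t * D a ≤ ∑ t, P a t * D t :=
    Finset.sum_le_sum fun t _ => mul_le_mul_of_nonneg_left (hmin t) (hP a t)
  rw [← Finset.sum_mul, hP1, one_mul] at h1
  linarith [h a, hc.2]

/-- Normalizing `V a = 0` frees the coordinate `u a` to store `c`, so the system is square and
injectivity suffices; the minimum principle for `Z u` and `-Z u` provides it. -/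
theorem exists_poisson_solution {P : Matrix ι ι ℝ} (hP : ∀ s t, 0 ≤ P s t)
    (hP1 : ∀ s, ∑ t, P s t = 1) {a : ι}
    (ha : ∀ s, Relation.ReflTransGen (fun s t => 0 < P s t) s a) (r : ι → ℝ) :
    ∃ (V : ι → ℝ) (c : ℝ), ∀ s, V s + c = r s + ∑ t, P s t * V t := by
  classical
  let Z : (ι → ℝ) → ι → ℝ := fun u s => if s = a then 0 else u s
  let L : (ι → ℝ) →ₗ[ℝ] (ι → ℝ) :=
    { toFun := fun u s => Z u s + u a - ∑ t, P s t * Z u t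
      map_add' := by
        intro u v
        have hZ : ∀ s, Z (u + v) s = Z u s + Z v s := by
          intro s; simp only [Z]; split_ifs <;> simp
        ext s
        simp only [hZ, Pi.add_apply, mul_add, Finset.sum_add_distrib]
        ring
      map_smul' := by
        intro k u
        have hZ : ∀ s, Z (k • u) s = k * Z u s := by
          intro s; simp only [Z]; split_ifs <;> simp
        ext s
        simp only [hZ, Pi.smul_apply, smul_eq_mul, RingHom.id_apply, mul_left_comm _ k,
          ← Finset.mul_sum]
        ring }
  have hinj : Function.Injective L := by
    rw [← LinearMap.ker_eq_bot, LinearMap.ker_eq_bot']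
    intro u hu
    have hu' : ∀ s, Z u s + u a = 0 + ∑ t, P s t * Z u t := by
      intro s
      have : Z u s + u a - ∑ t, P s t * Z u t = 0 := congrFun hu s
      linarith
    have h0 : 0 ≤ u a := by
      rcases gain_pos_or_le hP hP1 ha (d := fun _ => 0) (fun _ => le_rfl) hu' with h | h
      · exact h.le
      · exact h
    have hneg : ∀ s, -Z u s + -u a = 0 + ∑ t, P s t * -Z u t := by
      intro s
      simp only [mul_neg, Finset.sum_neg_distrib]
      linarith [hu' s]
    have h1 : 0 ≤ -u a := by
      rcases gain_pos_or_le hP hP1 ha (D := fun s => -Z u s) (d := fun _ => 0)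
        (fun _ => le_rfl) hneg with h | h
      · exact h.le
      · exact h
    have hua : u a = 0 := by linarith
    have hZa : Z u a = 0 := by simp [Z]
    ext s
    by_cases hs : s = a
    · rw [hs, hua]; rfl
    · have hZs : Z u s = u s := by simp [Z, hs]
      have h2 := superharmonic_min hP hP1 ha (D := Z u) (fun s => by linarith [hu' s]) s
      have h3 := superharmonic_min hP hP1 ha (D := fun s => -Z u s)
        (fun s => by linarith [hneg s]) s
      rw [Pi.zero_apply]
      linarith
  obtain ⟨u, hu⟩ := LinearMap.injective_iff_surjective.1 hinj r
  refine ⟨Z u, u a, fun s => ?_⟩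
  have : Z u s + u a - ∑ t, P s t * Z u t = r s := congrFun hu s
  linarith

/-- The time averages of the expected reward converge to the constant of the Poisson equation. -/
theorem tendsto_average_of_poisson [DecidableEq ι] {P : Matrix ι ι ℝ} (hP : ∀ s t, 0 ≤ P s t)
    (hP1 : ∀ s, ∑ t, P s t = 1) {V r : ι → ℝ} {c : ℝ}
    (h : ∀ s, V s + c = r s + ∑ t, P s t * V t) (s₀ : ι) :
    Filter.Tendsto (fun K : ℕ => (1 / ((K : ℝ) + 1)) *
      ∑ k ∈ Finset.range (K + 1), ∑ s, (P ^ k) s₀ s * r s) Filter.atTop (nhds c) := by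
  have hpow : ∀ k : ℕ, (∀ s t, 0 ≤ (P ^ k) s t) ∧ ∀ s, ∑ t, (P ^ k) s t = 1 := by
    intro k
    induction k with
    | zero =>
      refine ⟨fun s t => ?_, fun s => ?_⟩
      · rw [pow_zero, Matrix.one_apply]; split_ifs <;> norm_num
      · simp [Matrix.one_apply]
    | succ k ih =>
      refine ⟨fun s t => ?_, fun s => ?_⟩
      · rw [pow_succ, Matrix.mul_apply]
        exact Finset.sum_nonneg fun u _ => mul_nonneg (ih.1 s u) (hP u t)
      · simp only [pow_succ, Matrix.mul_apply]
        rw [Finset.sum_comm]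
        simp only [← Finset.mul_sum, hP1, mul_one, ih.2]
  let W : ℕ → ℝ := fun k => ∑ s, (P ^ k) s₀ s * V s
  -- Averaged over the law at time `k`, the Poisson equation telescopes.
  have hstep : ∀ k, ∑ s, (P ^ k) s₀ s * r s = c + (W k - W (k + 1)) := by
    intro k
    have h1 : W (k + 1) = ∑ s, (P ^ k) s₀ s * ∑ t, P s t * V t := by
      simp only [W, pow_succ, Matrix.mul_apply, Finset.sum_mul, Finset.mul_sum]
      rw [Finset.sum_comm]
      simp only [mul_assoc]
    have h2 : c = ∑ s, (P ^ k) s₀ s * c := by rw [← Finset.sum_mul, (hpow k).2, one_mul]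
    rw [h1, h2, ← Finset.sum_sub_distrib, ← Finset.sum_add_distrib]
    refine Finset.sum_congr rfl fun s _ => ?_
    linear_combination (-(P ^ k) s₀ s) * h s
  obtain ⟨B, hB⟩ : ∃ B : ℝ, ∀ k, |W k| ≤ B := by
    refine ⟨∑ s, |V s|, fun k => (Finset.abs_sum_le_sum_abs _ _).trans ?_⟩
    refine Finset.sum_le_sum fun s _ => ?_
    rw [abs_mul, abs_of_nonneg ((hpow k).1 _ _)]
    refine mul_le_of_le_one_left (abs_nonneg _) ?_
    rw [← (hpow k).2 s₀]
    exact Finset.single_le_sum (fun t _ => (hpow k).1 s₀ t) (Finset.mem_univ s)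
  have hlim : Filter.Tendsto (fun K : ℕ => (1 / ((K : ℝ) + 1)) * (W 0 - W (K + 1)))
      Filter.atTop (nhds 0) := by
    refine tendsto_one_div_add_atTop_nhds_zero_nat.zero_mul_isBoundedUnder_le ?_
    refine Filter.isBoundedUnder_of ⟨B + B, fun K => ?_⟩
    exact (abs_sub _ _).trans (add_le_add (hB 0) (hB (K + 1)))
  have := hlim.const_add c
  rw [add_zero] at this
  refine this.congr fun K => ?_
  simp only [hstep, Finset.sum_add_distrib, Finset.sum_range_sub', Finset.sum_const,
    Finset.card_range, nsmul_eq_mul]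
  have : (K : ℝ) + 1 ≠ 0 := by positivity
  push_cast
  field_simp

end StochasticMatrix

/-! ### The battery chain: transitions, gain and recurrence. -/

theorem Policy.transition_nonneg {M : Model} (μ : Policy M) (e e' : M.Level) :
    0 ≤ μ.transition e e' := by
  refine Finset.sum_nonneg fun x hx => mul_nonneg (M.prob_pos x hx).le ?_
  refine Finset.sum_nonneg fun b _ => mul_nonneg (M.harvest_nonneg b) ?_
  split_ifs <;> norm_num

/-- The level after a slot that starts at level `e`, spends `ρ` and harvests `b`. -/
def Model.next (M : Model) (e : M.Level) (ρ b : ℕ) : M.Level :=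
  ⟨min ((e : ℕ) - ρ + b) M.eMax, Nat.lt_succ_of_le (min_le_right _ _)⟩

theorem Policy.sum_transition_mul {M : Model} (μ : Policy M) (e : M.Level) (V : M.Level → ℝ) :
    ∑ e', μ.transition e e' * V e' = ∑ x ∈ M.channels, M.prob x *
      ∑ b ∈ Finset.range (M.bMax + 1), M.harvest b * V (M.next e (μ.power e x.1 x.2) b) := by
  simp only [Policy.transition, Finset.sum_mul]
  rw [Finset.sum_comm]
  refine Finset.sum_congr rfl fun x _ => ?_
  simp only [mul_assoc, Finset.sum_mul, ← Finset.mul_sum]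
  congr 1
  rw [Finset.sum_comm]
  refine Finset.sum_congr rfl fun b _ => ?_
  rw [← Finset.mul_sum]
  congr 1
  rw [Finset.sum_eq_single (M.next e (μ.power e x.1 x.2) b)]
  · simp [Model.next]
  · intro t _ ht
    rw [if_neg, zero_mul]
    intro h
    exact ht (Fin.ext h.symm)
  · simp

theorem Policy.sum_transition {M : Model} (μ : Policy M) (e : M.Level) :
    ∑ e', μ.transition e e' = 1 := by
  simpa [M.harvest_sum, M.prob_sum] using μ.sum_transition_mul e fun _ => 1

theorem Policy.secrecy_eq {M : Model} (μ : Policy M) {V : M.Level → ℝ} {c : ℝ}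
    (h : ∀ e, V e + c = μ.reward e + ∑ e', μ.transition e e' * V e') (e₀ : M.Level) :
    μ.secrecy e₀ = max 0 c := by
  rw [Policy.secrecy, (tendsto_average_of_poisson μ.transition_nonneg μ.sum_transition h
    e₀).liminf_eq]

theorem Policy.exists_isRecurrent_reaches {M : Model} (μ : Policy M) (e : M.Level) :
    ∃ a, μ.IsRecurrent a ∧ μ.Reaches e a := by
  classical
  let S : M.Level → Finset M.Level := fun a => Finset.univ.filter (μ.Reaches a)
  -- A reachable level whose own reachable set is smallest must be recurrent.
  obtain ⟨a, ha, hmin⟩ := Finset.exists_min_image (S e) (fun a => (S a).card)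
    ⟨e, by simp only [S, Finset.mem_filter, Finset.mem_univ, true_and]
           exact Relation.ReflTransGen.refl⟩
  simp only [S, Finset.mem_filter, Finset.mem_univ, true_and] at ha hmin
  refine ⟨a, fun b hb => ?_, ha⟩
  have hsub : S b ⊆ S a := fun t ht => by
    simp only [S, Finset.mem_filter, Finset.mem_univ, true_and] at ht ⊢
    exact hb.trans ht
  have heq := Finset.eq_of_subset_of_card_le hsub (hmin b (ha.trans hb))
  have : a ∈ S b := by
    rw [heq]
    simp only [S, Finset.mem_filter, Finset.mem_univ, true_and]
    exact Relation.ReflTransGen.refl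
  simpa [S] using this

theorem Policy.IsUnichain.reaches {M : Model} {μ : Policy M} (hμ : μ.IsUnichain) {a : M.Level}
    (ha : μ.IsRecurrent a) (e : M.Level) : μ.Reaches e a := by
  obtain ⟨b, hb, heb⟩ := μ.exists_isRecurrent_reaches e
  exact heb.trans (hμ b a hb ha)

theorem Policy.isUnichain_of_reaches {M : Model} {μ : Policy M} {a : M.Level}
    (h : ∀ e, μ.Reaches e a) : μ.IsUnichain :=
  fun e e' _ he' => (h e).trans (he' a (h e'))

/-- A chain that differs from `P` only in the row of `a` still reaches `a` if `P` does. -/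
theorem reaches_of_agree_off {ι : Type*} {R S : ι → ι → Prop} {a : ι}
    (hRS : ∀ s, s ≠ a → ∀ t, R s t → S s t) {s : ι} (h : Relation.ReflTransGen R s a) :
    Relation.ReflTransGen S s a := by
  -- The path is cut at its first visit to `a`, before the changed row matters.
  induction h using Relation.ReflTransGen.head_induction_on with
  | refl => exact Relation.ReflTransGen.refl
  | @head u v huv _ ih =>
    by_cases hu : u = a
    · rw [hu]
    · exact Relation.ReflTransGen.head (hRS u hu v huv) ih

/-! ### One-state deviations and the Bellman condition. -/

open Classical in
/-- The policy that spends `ρ` at level `a` in channel state `x`, and follows `μ` otherwise. -/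
noncomputable def Policy.modify {M : Model} (μ : Policy M) (a : M.Level) (x : ℝ × ℝ) (ρ : ℕ)
    (hρ : ρ ≤ (a : ℕ)) : Policy M where
  power e g h := if e = a ∧ (g, h) = x then ρ else μ.power e g h
  power_le e g h := by
    split_ifs with hx
    · rw [hx.1]; exact hρ
    · exact μ.power_le e g h

/-- Immediate reward plus expected continuation value `V` of spending `ρ` at level `e` in channel
state `x`. -/
noncomputable def Model.actionValue (M : Model) (V : M.Level → ℝ) (e : M.Level) (x : ℝ × ℝ) (ρ : ℕ) : ℝ :=
  secrecyRate M.coding x.1 x.2 ρ +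
    ∑ b ∈ Finset.range (M.bMax + 1), M.harvest b * V (M.next e ρ b)

theorem Policy.reward_add_sum {M : Model} (μ : Policy M) (V : M.Level → ℝ) (e : M.Level) :
    μ.reward e + ∑ e', μ.transition e e' * V e' =
      ∑ x ∈ M.channels, M.prob x * M.actionValue V e x (μ.power e x.1 x.2) := by
  rw [μ.sum_transition_mul, Policy.reward, ← Finset.sum_add_distrib]
  simp only [Model.actionValue, mul_add]

theorem secrecyRate_nonneg (s : Coding) {g h ρ : ℝ} (hh : 0 ≤ h) (hgh : h ≤ g) (hρ : 0 ≤ ρ) :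
    0 ≤ secrecyRate s g h ρ := by
  have : Real.logb 2 (1 + h * ρ) ≤ Real.logb 2 (1 + g * ρ) :=
    Real.logb_le_logb_of_le one_lt_two (by positivity)
      (by linarith [mul_le_mul_of_nonneg_right hgh hρ])
  cases s <;> simp only [secrecyRate, min_eq_right hgh] <;> linarith

theorem secrecyRate_of_le (s : Coding) {g h : ℝ} (hgh : h ≤ g) (ρ : ℝ) :
    secrecyRate s g h ρ = Real.logb 2 (1 + g * ρ) - Real.logb 2 (1 + h * ρ) := by
  cases s <;> simp only [secrecyRate, min_eq_right hgh]

theorem Policy.IsOptimalSecrecy.reward_nonneg {M : Model} {μ : Policy M}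
    (hμ : μ.IsOptimalSecrecy) (e : M.Level) : 0 ≤ μ.reward e := by
  refine Finset.sum_nonneg fun x hx => mul_nonneg (M.prob_pos x hx).le ?_
  rcases le_total x.1 x.2 with h | h
  · rw [hμ.silent_of_le e x hx h]
    cases M.coding <;> simp [secrecyRate]
  · exact secrecyRate_nonneg _ (M.gains_nonneg x hx).2 h (Nat.cast_nonneg _)

/-- At a recurrent level, an optimal policy maximizes immediate reward plus continuation value in
every channel state. -/
theorem Policy.IsOptimalSecrecy.exists_bellman {M : Model} {μ : Policy M}
    (hμ : μ.IsOptimalSecrecy) {a : M.Level} (ha : μ.IsRecurrent a) :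
    ∃ V : M.Level → ℝ, ∀ x ∈ M.channels, ∀ ρ : ℕ, ρ ≤ (a : ℕ) →
      M.actionValue V a x ρ ≤ M.actionValue V a x (μ.power a x.1 x.2) := by
  have hreach := hμ.unichain.reaches ha
  obtain ⟨V, c, hV⟩ :=
    exists_poisson_solution μ.transition_nonneg μ.sum_transition hreach μ.reward
  refine ⟨V, fun x hx ρ hρ => ?_⟩
  by_contra! hlt
  set ν := μ.modify a x ρ hρ
  have hpower : ∀ e y, ¬ (e = a ∧ y = x) → ν.power e y.1 y.2 = μ.power e y.1 y.2 :=
    fun e y hy => if_neg hy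
  have hpowerx : ν.power a x.1 x.2 = ρ := if_pos ⟨rfl, rfl⟩
  have hνreach : ∀ e, ν.Reaches e a := by
    intro e
    refine reaches_of_agree_off (fun s hs t hst => ?_) (hreach e)
    have : ν.transition s t = μ.transition s t := by
      simp only [Policy.transition]
      refine Finset.sum_congr rfl fun y _ => ?_
      rw [hpower s y fun h => hs h.1]
    rwa [this]
  obtain ⟨U, d, hU⟩ :=
    exists_poisson_solution ν.transition_nonneg ν.sum_transition hνreach ν.reward
  -- `secrecy` truncates at zero, so it reveals the gain of `μ` only once that is known to be
  -- nonnegative.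
  have hc : 0 ≤ c := by
    rcases gain_pos_or_le μ.transition_nonneg μ.sum_transition hreach hμ.reward_nonneg hV
      with h | h
    · exact h.le
    · exact (hμ.reward_nonneg a).trans h
  -- the one-step gain of `ν` over `μ`, measured with the value function of `μ`
  let w : M.Level → ℝ := fun e =>
    (ν.reward e + ∑ e', ν.transition e e' * V e') -
      (μ.reward e + ∑ e', μ.transition e e' * V e')
  have hwoff : ∀ e, e ≠ a → w e = 0 := by
    intro e he
    simp only [w, Policy.reward_add_sum]
    rw [sub_eq_zero]
    refine Finset.sum_congr rfl fun y _ => ?_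
    rw [hpower e y fun h => he h.1]
  have hwa : 0 < w a := by
    simp only [w, Policy.reward_add_sum]
    rw [sub_pos]
    refine Finset.sum_lt_sum (fun y hy => ?_) ⟨x, hx, ?_⟩
    · by_cases hyx : y = x
      · subst hyx
        rw [hpowerx]
        exact mul_le_mul_of_nonneg_left hlt.le (M.prob_pos y hy).le
      · rw [hpower a y fun h => hyx h.2]
    · rw [hpowerx]
      exact mul_lt_mul_of_pos_left hlt (M.prob_pos x hx)
  have hw : ∀ e, 0 ≤ w e := by
    intro e
    by_cases he : e = a
    · rw [he]; exact hwa.le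
    · exact (hwoff e he).ge
  -- Subtracting the two equations makes `U - V` solve the Poisson equation of `ν` with reward `w`
  -- and gain `d - c`.
  have hgain : 0 < d - c := by
    have := gain_pos_or_le ν.transition_nonneg ν.sum_transition hνreach hw
      (D := fun e => U e - V e) (c := d - c) (fun e => by
        simp only [w, mul_sub, Finset.sum_sub_distrib]
        linarith [hU e, hV e])
    rcases this with h | h
    · exact h
    · exact hwa.trans_le h
  have hopt := hμ.optimal ν (Policy.isUnichain_of_reaches hνreach) a
  rw [Policy.secrecy_eq ν hU, Policy.secrecy_eq μ hV, max_eq_right hc] at hopt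
  linarith [le_max_right 0 d]

/-! ### Increasing differences and monotone powers. -/

theorem logb_sub_logb_lt {g g' ρ ρ' : ℝ} (hg : 0 ≤ g) (hgg : g < g') (hρ : 0 ≤ ρ) (hρρ : ρ < ρ') :
    Real.logb 2 (1 + g' * ρ) + Real.logb 2 (1 + g * ρ') <
      Real.logb 2 (1 + g' * ρ') + Real.logb 2 (1 + g * ρ) := by
  have hg' : 0 ≤ g' := hg.trans hgg.le
  have hρ' : 0 ≤ ρ' := hρ.trans hρρ.le
  rw [← Real.logb_mul (by positivity) (by positivity),
    ← Real.logb_mul (by positivity) (by positivity)]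
  refine Real.logb_lt_logb one_lt_two (by positivity) ?_
  -- The two products differ by exactly `(g' - g) * (ρ' - ρ)`.
  nlinarith [mul_pos (sub_pos.2 hgg) (sub_pos.2 hρρ)]

/-- Strictly increasing differences of the rate force monotonicity of the optimal power. -/
theorem Policy.IsOptimalSecrecy.power_le_power {M : Model} {μ : Policy M}
    (hμ : μ.IsOptimalSecrecy) {x y : ℝ × ℝ} (hx : x ∈ M.channels) (hy : y ∈ M.channels)
    (hdiff : ∀ ρ ρ' : ℝ, 0 ≤ ρ → ρ < ρ' →
      secrecyRate M.coding y.1 y.2 ρ + secrecyRate M.coding x.1 x.2 ρ' <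
        secrecyRate M.coding y.1 y.2 ρ' + secrecyRate M.coding x.1 x.2 ρ) (e : M.Level) :
    μ.power e x.1 x.2 ≤ μ.power e y.1 y.2 := by
  by_cases he : μ.IsRecurrent e
  · obtain ⟨V, hV⟩ := hμ.exists_bellman he
    by_contra! hlt
    -- Each state is tested with the other's power; in the sum the continuation values cancel,
    -- contradicting `h3`.
    have h1 := hV x hx _ (μ.power_le e y.1 y.2)
    have h2 := hV y hy _ (μ.power_le e x.1 x.2)
    have h3 := hdiff _ _ (Nat.cast_nonneg (μ.power e y.1 y.2)) (Nat.cast_lt.2 hlt)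
    simp only [Model.actionValue] at h1 h2
    linarith
  · rw [hμ.silent_of_transient e he x hx]
    exact Nat.zero_le _

end EnergyHarvestingSecrecy

theorem theorem3 (M : EnergyHarvestingSecrecy.Model) (μ : EnergyHarvestingSecrecy.Policy M)
    (hμ : μ.IsOptimalSecrecy) :
    (∀ (e : M.Level) (g' g'' h : ℝ), (g', h) ∈ M.channels → (g'', h) ∈ M.channels →
      g' ≤ g'' → μ.power e g' h ≤ μ.power e g'' h) ∧
    (∀ (e : M.Level) (g h' h'' : ℝ), (g, h') ∈ M.channels → (g, h'') ∈ M.channels →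
      h' ≤ h'' → μ.power e g h'' ≤ μ.power e g h') := by
  refine ⟨fun e g' g'' h hx hy hgg => ?_, fun e g h' h'' hx hy hhh => ?_⟩
  · rcases hgg.eq_or_lt with rfl | hlt
    · exact le_rfl
    rcases le_or_gt g' h with hgh | hgh
    · rw [show μ.power e g' h = 0 from hμ.silent_of_le e _ hx hgh]
      exact Nat.zero_le _
    -- Both legitimate gains now exceed `h`, so the two codings have the same rate and the terms in
    -- `h` cancel.
    refine hμ.power_le_power hx hy (fun ρ ρ' hρ hρρ => ?_) e
    rw [EnergyHarvestingSecrecy.secrecyRate_of_le _ (hgh.trans hlt).le,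
      EnergyHarvestingSecrecy.secrecyRate_of_le _ hgh.le,
      EnergyHarvestingSecrecy.secrecyRate_of_le _ (hgh.trans hlt).le,
      EnergyHarvestingSecrecy.secrecyRate_of_le _ hgh.le]
    linarith [EnergyHarvestingSecrecy.logb_sub_logb_lt (M.gains_nonneg _ hx).1 hlt hρ hρρ]
  · rcases hhh.eq_or_lt with rfl | hlt
    · exact le_rfl
    rcases le_or_gt g h'' with hgh | hgh
    · rw [show μ.power e g h'' = 0 from hμ.silent_of_le e _ hy hgh]
      exact Nat.zero_le _
    -- The roles are swapped because the eavesdropper's logarithm enters with a minus sign.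
    refine hμ.power_le_power hy hx (fun ρ ρ' hρ hρρ => ?_) e
    rw [EnergyHarvestingSecrecy.secrecyRate_of_le _ (hlt.trans hgh).le,
      EnergyHarvestingSecrecy.secrecyRate_of_le _ hgh.le,
      EnergyHarvestingSecrecy.secrecyRate_of_le _ (hlt.trans hgh).le,
      EnergyHarvestingSecrecy.secrecyRate_of_le _ hgh.le]
    linarith [EnergyHarvestingSecrecy.logb_sub_logb_lt (M.gains_nonneg _ hx).2 hlt hρ hρρ]
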